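/- All graphs are finite and simple. A set $D$ of vertices of a graph $G$ is a certified dominating set if every vertex outside $D$ has a neighbour in $D$ and every vertex in $D$ has either no neighbour or at least two neighbours outside $D$; $\gamma_{\rm cer}(G)$ is the minimum cardinality of such a set. The corona of a graph $H$ is the graph obtained from $H$ by attaching one new pendant vertex to each vertex of $H$. A leaf is a vertex of degree one, and a support vertex is a neighbour of a leaf. A diadem graph is a graph obtained from the corona of some graph by adding one new vertex and joining it to exactly one vertex, which is a support vertex of the corona. Theorem. Let $G$ be a graph of order $n\ge 3$. Then $\gamma_{\rm cer}(G)=n-2$ if and only if, up to isomorphism, one of the following holds: (a) $G$ is $C_3$, $C_4$, or a diadem graph; (b) $G$ is the disjoint union of $C_3$, $C_4$, or a diadem graph with $k\ge 0$ isolated vertices; (c) $G$ is the disjoint union of $C_3$, $C_4$, or a diadem graph with the corona of some graph and with $k\ge 0$ isolated vertices. -/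

import Mathlib

open SimpleGraph

universe u

namespace CertDom

/-- `D` is a certified dominating set of `G`: every vertex outside `D` has a neighbour in `D`, and
every vertex of `D` has either no neighbour or at least two neighbours outside `D`. -/
def IsCertifiedDominating {V : Type u} (G : SimpleGraph V) (D : Set V) : Prop :=
  (∀ v, v ∉ D → ∃ w ∈ D, G.Adj v w) ∧
    ∀ v ∈ D, G.neighborSet v \ D = ∅ ∨ (G.neighborSet v \ D).Nontrivial

/-- The whole vertex set is certified dominating, so the minimum below is over a nonempty set. -/
theorem isCertifiedDominating_univ {V : Type u} (G : SimpleGraph V) :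
    IsCertifiedDominating G Set.univ :=
  ⟨fun v hv => absurd (Set.mem_univ v) hv, fun _ _ => Or.inl (by simp)⟩

/-- The certified domination number: the minimum cardinality of a certified dominating set
of a finite graph. -/
noncomputable def certDomNumber {V : Type u} [Fintype V] (G : SimpleGraph V) : ℕ :=
  sInf {k | ∃ D : Finset V, IsCertifiedDominating G (D : Set V) ∧ D.card = k}

/-- The corona `H ∘ K₁`: a new vertex `Sum.inr w` is attached by one edge to each vertex
`Sum.inl w` of `H`. -/
def corona {W : Type u} (H : SimpleGraph W) : SimpleGraph (W ⊕ W) where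
  Adj x y := match x, y with
    | Sum.inl a, Sum.inl b => H.Adj a b
    | Sum.inl a, Sum.inr b => a = b
    | Sum.inr a, Sum.inl b => a = b
    | Sum.inr _, Sum.inr _ => False
  symm := ⟨by
    rintro (a | a) (b | b) h
    · exact SimpleGraph.Adj.symm h
    · exact Eq.symm h
    · exact Eq.symm h
    · exact h⟩
  loopless := ⟨by
    rintro (a | a) h
    · exact H.irrefl h
    · exact h⟩

/-- A leaf is a vertex of degree one. -/
def IsLeaf {V : Type u} (G : SimpleGraph V) (v : V) : Prop := ∃! w, G.Adj v w

/-- A support vertex is a neighbour of a leaf. -/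
def IsSupport {V : Type u} (G : SimpleGraph V) (s : V) : Prop := ∃ l, IsLeaf G l ∧ G.Adj l s

/-- The graph obtained from `G` by adding a new vertex `none` and joining it to `s` only. -/
def addPendant {V : Type u} (G : SimpleGraph V) (s : V) : SimpleGraph (Option V) where
  Adj x y := match x, y with
    | some a, some b => G.Adj a b
    | some a, none => a = s
    | none, some b => b = s
    | none, none => False
  symm := ⟨by
    rintro (_ | a) (_ | b) h
    · exact h
    · exact h
    · exact h
    · exact SimpleGraph.Adj.symm h⟩
  loopless := ⟨by
    rintro (_ | a) h
    · exact h
    · exact G.irrefl h⟩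

/-- `G` is (isomorphic to) the diadem graph of some graph `H`: a new vertex is added to the corona
of `H` and joined to a support vertex of that corona. -/
def IsDiadem {V : Type u} (G : SimpleGraph V) : Prop :=
  ∃ (W : Type u) (H : SimpleGraph W) (s : W ⊕ W), IsSupport (corona H) s ∧
    Nonempty (G ≃g addPendant (corona H) s)

/-- `G` is `C₃`, `C₄` or a diadem graph. -/
def IsC3OrC4OrDiadem {V : Type u} (G : SimpleGraph V) : Prop :=
  Nonempty (G ≃g cycleGraph 3) ∨ Nonempty (G ≃g cycleGraph 4) ∨ IsDiadem G

end CertDom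

namespace CertDom

/-! Pass to complements ("shadows"): the claim becomes that the largest shadow has exactly two
elements. No support vertex lies in a shadow, which forces every shadow of a corona to be empty. A
second leaf at a support vertex creates a shadow of size two and nothing larger. Shadows of a
disjoint union are computed componentwise, so the listed graphs all have shadow number two.

Conversely, call a non-isolated vertex inner if it is neither a leaf nor a support vertex. If there
is no inner vertex, the two shadow vertices are leaves at a common support vertex, and no third leaf
shares its support vertex with another leaf. Deleting one of the two leaves a corona plus isolated
vertices.

If inner vertices exist, take a smallest set D of them that dominates the inner vertices with the
help of the support vertices. By `exists_minimum_dominating` each vertex of D can be assumed to have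
two inner neighbours outside D. The inner vertices outside D, enlarged by suitable leaves, then form
a shadow (`isShadow_leafExtension`), so there are at most two of them. Together with the minimality
of D this leaves only a triangle or a 4-cycle, with no edge to a support vertex; the remaining
non-isolated vertices form a corona. -/

variable {V : Type u} {A B : Type*}

/-! ### Shadows and the certified domination number -/

/-- The complement of a certified dominating set: every vertex of `X` has a neighbour outside `X`,
and no vertex outside `X` has exactly one neighbour in `X`. -/
def IsShadow (G : SimpleGraph A) (X : Set A) : Prop :=
  (∀ x ∈ X, ∃ w ∉ X, G.Adj x w) ∧
    ∀ v ∉ X, ∀ x ∈ X, G.Adj v x → ∃ y ∈ X, y ≠ x ∧ G.Adj v y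

/-- The largest shadow has two elements. -/
def ShadowNumberTwo (G : SimpleGraph A) : Prop :=
  (∃ x y, x ≠ y ∧ IsShadow G {x, y}) ∧
    ∀ X, IsShadow G X → ∀ x ∈ X, ∀ y ∈ X, ∀ z ∈ X, x = y ∨ x = z ∨ y = z

/-- Only the empty set is a shadow. -/
def ShadowNumberZero (G : SimpleGraph A) : Prop := ∀ X, IsShadow G X → X = ∅

theorem isCertifiedDominating_iff (G : SimpleGraph V) (D : Set V) :
    IsCertifiedDominating G D ↔ IsShadow G Dᶜ := by
  unfold IsCertifiedDominating IsShadow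
  refine and_congr ?_ ?_
  · simp
  · constructor
    · intro h v hv x hx hvx
      rcases h v (by simpa using hv) with h | h
      · exact absurd (show x ∈ G.neighborSet v \ D from ⟨hvx, hx⟩) (by simp [h])
      · obtain ⟨y, ⟨hy, hyD⟩, hne⟩ := h.exists_ne x
        exact ⟨y, hyD, hne, hy⟩
    · intro h v hv
      rcases (G.neighborSet v \ D).eq_empty_or_nonempty with he | ⟨x, hx, hxD⟩
      · exact Or.inl he
      · obtain ⟨y, hy, hne, hvy⟩ := h v (by simpa using hv) x hxD hx
        exact Or.inr ⟨x, ⟨hx, hxD⟩, y, ⟨hvy, hy⟩, hne.symm⟩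

theorem certDomNumber_eq_iff [Fintype V] (G : SimpleGraph V) (hn : 3 ≤ Fintype.card V) :
    certDomNumber G = Fintype.card V - 2 ↔ ShadowNumberTwo G := by
  classical
  have hne : {k | ∃ D : Finset V, IsCertifiedDominating G (D : Set V) ∧ D.card = k}.Nonempty :=
    ⟨_, Finset.univ, by simpa using isCertifiedDominating_univ G, rfl⟩
  have hcard : ∀ D : Finset V, Dᶜ.card + D.card = Fintype.card V := fun D =>
    Finset.card_compl_add_card D
  constructor
  · intro h
    constructor
    · obtain ⟨D, hD, hc⟩ := Nat.sInf_mem hne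
      have hc' : D.card = Fintype.card V - 2 := hc.trans h
      -- The order bound keeps the subtraction `Fintype.card V - 2` from truncating.
      have h2 : Dᶜ.card = 2 := by have := hcard D; omega
      obtain ⟨x, y, hxy, he⟩ := Finset.card_eq_two.1 h2
      refine ⟨x, y, hxy, ?_⟩
      rw [isCertifiedDominating_iff, ← Finset.coe_compl, he] at hD
      simpa using hD
    · intro X hX x hx y hy z hz
      by_contra hcon
      push Not at hcon
      let D : Finset V := X.toFinsetᶜ
      have hD : IsCertifiedDominating G (D : Set V) := by
        rw [isCertifiedDominating_iff]; simpa [D] using hX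
      have h1 : certDomNumber G ≤ D.card := Nat.sInf_le ⟨D, hD, rfl⟩
      have h3 : 2 < Dᶜ.card := Finset.two_lt_card.2
        ⟨x, by simpa [D], y, by simpa [D], z, by simpa [D], hcon.1, hcon.2.1, hcon.2.2⟩
      have := hcard D
      omega
  · rintro ⟨⟨x, y, hxy, hX⟩, hmax⟩
    apply le_antisymm
    · refine Nat.sInf_le ⟨({x, y} : Finset V)ᶜ, ?_, ?_⟩
      · rw [isCertifiedDominating_iff, Finset.coe_compl, compl_compl]
        simpa using hX
      · rw [Finset.card_compl, Finset.card_pair hxy]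
    · refine le_csInf hne ?_
      rintro k ⟨D, hD, rfl⟩
      rw [isCertifiedDominating_iff] at hD
      by_contra hlt
      have h3 : 2 < Dᶜ.card := by have := hcard D; omega
      obtain ⟨a, ha, b, hb, c, hc, hab, hac, hbc⟩ := Finset.two_lt_card.1 h3
      rcases hmax _ hD a (by simpa using ha) b (by simpa using hb) c (by simpa using hc)
        with h | h | h
      exacts [hab h, hac h, hbc h]

/-! ### Isomorphisms and disjoint unions -/

theorem IsShadow.preimage {G : SimpleGraph A} {G' : SimpleGraph B} (e : G ≃g G') {X : Set B}
    (hX : IsShadow G' X) : IsShadow G (e ⁻¹' X) := by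
  constructor
  · intro x hx
    obtain ⟨w, hw, hxw⟩ := hX.1 _ hx
    exact ⟨e.symm w, by simpa using hw, by rw [← e.map_adj_iff]; simpa using hxw⟩
  · intro v hv x hx hvx
    obtain ⟨y, hy, hne, hvy⟩ := hX.2 (e v) hv (e x) hx (e.map_adj_iff.2 hvx)
    refine ⟨e.symm y, by simpa using hy, ?_, by rw [← e.map_adj_iff]; simpa using hvy⟩
    rintro rfl
    simp at hne

theorem ShadowNumberTwo.of_iso {G : SimpleGraph A} {G' : SimpleGraph B} (e : G ≃g G')
    (h : ShadowNumberTwo G') : ShadowNumberTwo G := by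
  obtain ⟨⟨x, y, hxy, hX⟩, hmax⟩ := h
  refine ⟨⟨e.symm x, e.symm y, by simpa using hxy, ?_⟩, ?_⟩
  · convert hX.preimage e using 1
    ext v
    simp [RelIso.eq_symm_apply]
  · intro X hX x hx y hy z hz
    simpa using hmax _ (hX.preimage e.symm) (e x) (by simpa) (e y) (by simpa) (e z) (by simpa)

theorem isShadow_empty (G : SimpleGraph A) : IsShadow G ∅ := by simp [IsShadow]

theorem isShadow_sum_iff {G : SimpleGraph A} {G' : SimpleGraph B} {X : Set (A ⊕ B)} :
    IsShadow (G ⊕g G') X ↔ IsShadow G (Sum.inl ⁻¹' X) ∧ IsShadow G' (Sum.inr ⁻¹' X) := by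
  simp only [IsShadow, Sum.forall, Sum.exists, SimpleGraph.sum_adj, Set.mem_preimage]
  simp
  tauto

theorem ShadowNumberTwo.sum {G : SimpleGraph A} {G' : SimpleGraph B}
    (h : ShadowNumberTwo G) (h' : ShadowNumberZero G') : ShadowNumberTwo (G ⊕g G') := by
  obtain ⟨⟨x, y, hxy, hX⟩, hmax⟩ := h
  refine ⟨⟨.inl x, .inl y, by simpa using hxy, isShadow_sum_iff.2 ⟨?_, ?_⟩⟩, ?_⟩
  · convert hX using 1
    ext v
    simp
  · convert isShadow_empty G' using 1
    ext v
    simp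
  · intro X hX
    rw [isShadow_sum_iff] at hX
    have h0 := h' _ hX.2
    have hr : ∀ b, Sum.inr b ∉ X := fun b hb => by
      have : b ∈ Sum.inr ⁻¹' X := hb
      simp [h0] at this
    rintro (x | x) hx (y | y) hy (z | z) hz
    · simpa using hmax _ hX.1 x hx y hy z hz
    all_goals first
      | exact absurd hx (hr _)
      | exact absurd hy (hr _)
      | exact absurd hz (hr _)

theorem shadowNumberZero_bot : ShadowNumberZero (⊥ : SimpleGraph A) := by
  intro X hX
  ext x
  simp only [Set.mem_empty_iff_false, iff_false]
  intro hx
  obtain ⟨w, -, hw⟩ := hX.1 x hx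
  exact hw

/-! ### Support vertices, coronas and diadem graphs -/

/-- If `s` were in the shadow, its leaf would have no neighbour outside when it lies in the shadow,
and exactly one neighbour inside when it does not. -/
theorem IsShadow.not_mem_of_isSupport {G : SimpleGraph V} {X : Set V} (hX : IsShadow G X) {s : V}
    (hs : IsSupport G s) : s ∉ X := by
  obtain ⟨l, ⟨t, -, hu⟩, hls⟩ := hs
  intro hsX
  by_cases hl : l ∈ X
  · obtain ⟨w, hw, hlw⟩ := hX.1 l hl
    rw [hu w hlw, ← hu s hls] at hw
    exact hw hsX
  · obtain ⟨y, -, hne, hly⟩ := hX.2 l hl s hsX hls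
    exact hne ((hu y hly).trans (hu s hls).symm)

theorem isSupport_corona_inl (H : SimpleGraph V) (a : V) : IsSupport (corona H) (Sum.inl a) := by
  refine ⟨Sum.inr a, ⟨Sum.inl a, rfl, ?_⟩, rfl⟩
  rintro (b | b) h
  · exact congrArg Sum.inl (Eq.symm h)
  · exact h.elim

/-- Base vertices are support vertices, hence outside every shadow; a pendant vertex in a shadow
would then be the only shadow neighbour of its base vertex. -/
theorem shadowNumberZero_corona (H : SimpleGraph V) : ShadowNumberZero (corona H) := by
  intro X hX
  have hl : ∀ a, Sum.inl a ∉ X := fun a => hX.not_mem_of_isSupport (isSupport_corona_inl H a)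
  ext x
  simp only [Set.mem_empty_iff_false, iff_false]
  intro hx
  rcases x with a | a
  · exact hl a hx
  · obtain ⟨y | y, hy, hne, hay⟩ := hX.2 _ (hl a) (.inr a) hx rfl
    · exact hl y hy
    · exact hne (congrArg Sum.inr (Eq.symm hay))

/-- The new vertex and the old leaf `l` are twins at `s`, and together they form a shadow. From any
shadow one obtains a shadow of `G` by dropping the new vertex and suitably adjusting the membership
of `l`; since that shadow is empty, nothing besides the twins can occur. -/
theorem shadowNumberTwo_addPendant {G : SimpleGraph V} (hG : ShadowNumberZero G) {s : V}
    (hs : IsSupport G s) : ShadowNumberTwo (addPendant G s) := by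
  obtain ⟨l, ⟨t, -, hu⟩, hls⟩ := hs
  have hl : ∀ v, G.Adj l v → v = s := fun v hv => (hu v hv).trans (hu s hls).symm
  have hne : l ≠ s := hls.ne
  have hsS : IsSupport (addPendant G s) (some s) := by
    refine ⟨none, ⟨some s, rfl, ?_⟩, rfl⟩
    rintro (_ | b) h
    · exact h.elim
    · exact congrArg some h
  refine ⟨⟨none, some l, by simp, ?_, ?_⟩, ?_⟩
  · rintro x (rfl | rfl)
    · exact ⟨some s, by simp [hne.symm], rfl⟩
    · exact ⟨some s, by simp [hne.symm], hls⟩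
  · rintro (_ | v) hv x (rfl | rfl) h
    · exact h.elim
    · simp at hv
    · obtain rfl : v = s := h
      exact ⟨some l, by simp, by simp, hls.symm⟩
    · obtain rfl : v = s := hl v (SimpleGraph.Adj.symm h)
      exact ⟨none, by simp, by simp, rfl⟩
  · intro X hX
    have hsX := hX.not_mem_of_isSupport hsS
    suffices hsub : ∀ v, some v ∈ X → v = l by
      have : ∀ o ∈ X, o = none ∨ o = some l := by
        rintro (_ | v) hv
        · exact Or.inl rfl
        · exact Or.inr (congrArg some (hsub v hv))
      intro x hx y hy z hz
      rcases this x hx with rfl | rfl <;> rcases this y hy with rfl | rfl <;>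
        rcases this z hz with rfl | rfl <;> simp
    have hdom : ∀ x, some x ∈ X → ∃ w, some w ∉ X ∧ G.Adj x w := by
      intro x hx
      obtain ⟨_ | w, hw, hxw⟩ := hX.1 _ hx
      · obtain rfl : x = s := hxw
        exact absurd hx hsX
      · exact ⟨w, hw, hxw⟩
    have htwo : ∀ v, v ≠ s → some v ∉ X → ∀ x, some x ∈ X → G.Adj v x →
        ∃ y, some y ∈ X ∧ y ≠ x ∧ G.Adj v y := by
      intro v hvs hv x hx hvx
      obtain ⟨_ | y, hy, hyx, hvy⟩ := hX.2 _ hv (some x) hx hvx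
      · exact absurd hvy hvs
      · exact ⟨y, hy, by simpa using hyx, hvy⟩
    by_cases hex : ∃ y, some y ∈ X ∧ y ≠ l ∧ G.Adj s y
    · obtain ⟨y, hy, hyl, hsy⟩ := hex
      -- When `s` has another shadow neighbour, `l` can be put in: it gives `s` a second one. The
      -- result is nonempty, a contradiction.
      have hY : IsShadow G {v | some v ∈ X ∨ v = l} := by
        constructor
        · rintro x (hx | rfl)
          · obtain ⟨w, hw, hxw⟩ := hdom x hx
            refine ⟨w, ?_, hxw⟩
            rintro (hw' | rfl)
            · exact hw hw'
            · obtain rfl := hl x hxw.symm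
              exact hsX hx
          · exact ⟨s, by simp [hsX, hne.symm], hls⟩
        · intro v hv x hx hvx
          simp only [Set.mem_ofPred_eq, not_or] at hv
          by_cases hvs : v = s
          · subst hvs
            by_cases hxl : x = l
            · exact ⟨y, Or.inl hy, by rwa [hxl], hsy⟩
            · exact ⟨l, Or.inr rfl, Ne.symm hxl, hls.symm⟩
          · rcases hx with hx | rfl
            · obtain ⟨z, hz, hzx, hvz⟩ := htwo v hvs hv.1 x hx hvx
              exact ⟨z, Or.inl hz, hzx, hvz⟩
            · exact absurd (hl v hvx.symm) hvs
      exact absurd (show l ∈ {v | some v ∈ X ∨ v = l} from Or.inr rfl) (by simp [hG _ hY])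
    · push Not at hex
      -- Otherwise taking `l` out leaves `s` with no shadow neighbour at all, which is also allowed.
      have hY : IsShadow G {v | some v ∈ X ∧ v ≠ l} := by
        constructor
        · rintro x ⟨hx, hxl⟩
          obtain ⟨w, hw, hxw⟩ := hdom x hx
          exact ⟨w, fun h => hw h.1, hxw⟩
        · rintro v hv x ⟨hx, hxl⟩ hvx
          have hvs : v ≠ s := by
            rintro rfl
            exact hex x hx hxl hvx
          have hvl : v ≠ l := by
            rintro rfl
            obtain rfl := hl x hvx
            exact hsX hx
          obtain ⟨z, hz, hzx, hvz⟩ := htwo v hvs (fun h => hv ⟨h, hvl⟩) x hx hvx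
          refine ⟨z, ⟨hz, ?_⟩, hzx, hvz⟩
          rintro rfl
          exact hvs (hl v hvz.symm)
      intro v hv
      by_contra hvl
      exact absurd (show v ∈ {v | some v ∈ X ∧ v ≠ l} from ⟨hv, hvl⟩) (by simp [hG _ hY])

/-! ### The cycles of length three and four -/

instance (n : ℕ) (G : SimpleGraph (Fin n)) [DecidableRel G.Adj] (X : Finset (Fin n)) :
    Decidable (IsShadow G (X : Set (Fin n))) :=
  haveI h₁ : Decidable (∀ x ∈ X, ∃ w, w ∉ X ∧ G.Adj x w) := inferInstance
  haveI h₂ : Decidable (∀ v, v ∉ X → ∀ x ∈ X, G.Adj v x → ∃ y ∈ X, y ≠ x ∧ G.Adj v y) :=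
    inferInstance
  decidable_of_iff ((∀ x ∈ X, ∃ w, w ∉ X ∧ G.Adj x w) ∧
    ∀ v, v ∉ X → ∀ x ∈ X, G.Adj v x → ∃ y ∈ X, y ≠ x ∧ G.Adj v y) (by simp [IsShadow])

theorem shadowNumberTwo_cycleGraph_three : ShadowNumberTwo (cycleGraph 3) := by
  classical
  refine ⟨⟨0, 1, by decide, ?_⟩, ?_⟩
  · have : IsShadow (cycleGraph 3) (({0, 1} : Finset (Fin 3)) : Set (Fin 3)) := by decide
    simpa using this
  · intro X
    have : ∀ X : Finset (Fin 3), IsShadow (cycleGraph 3) (X : Set (Fin 3)) →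
        ∀ x ∈ X, ∀ y ∈ X, ∀ z ∈ X, x = y ∨ x = z ∨ y = z := by decide
    simpa using this X.toFinset

theorem shadowNumberTwo_cycleGraph_four : ShadowNumberTwo (cycleGraph 4) := by
  classical
  refine ⟨⟨0, 2, by decide, ?_⟩, ?_⟩
  · have : IsShadow (cycleGraph 4) (({0, 2} : Finset (Fin 4)) : Set (Fin 4)) := by decide
    simpa using this
  · intro X
    have : ∀ X : Finset (Fin 4), IsShadow (cycleGraph 4) (X : Set (Fin 4)) →
        ∀ x ∈ X, ∀ y ∈ X, ∀ z ∈ X, x = y ∨ x = z ∨ y = z := by decide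
    simpa using this X.toFinset

theorem IsC3OrC4OrDiadem.shadowNumberTwo {G : SimpleGraph V} (h : IsC3OrC4OrDiadem G) :
    ShadowNumberTwo G := by
  rcases h with ⟨⟨e⟩⟩ | ⟨⟨e⟩⟩ | ⟨W, H, s, hs, ⟨e⟩⟩
  · exact shadowNumberTwo_cycleGraph_three.of_iso e
  · exact shadowNumberTwo_cycleGraph_four.of_iso e
  · exact (shadowNumberTwo_addPendant (shadowNumberZero_corona H) hs).of_iso e

/-! ### Minimum dominating sets with two outside neighbours -/

/-- Among the subsets of `R` that, together with `S`, dominate `R`, there is one of minimum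
cardinality each of whose vertices has two neighbours in the rest of `R`. -/
theorem exists_minimum_dominating [Fintype V] (G : SimpleGraph V) (R S : Set V)
    (hdeg : ∀ r ∈ R, ∀ x, ∃ y, y ≠ x ∧ G.Adj r y ∧ (y ∈ R ∨ y ∈ S)) :
    ∃ D : Finset V, (D : Set V) ⊆ R ∧
      (∀ r ∈ R, r ∉ D → ∃ w, (w ∈ D ∨ w ∈ S) ∧ G.Adj r w) ∧
      (∀ D' : Finset V, (D' : Set V) ⊆ R →
        (∀ r ∈ R, r ∉ D' → ∃ w, (w ∈ D' ∨ w ∈ S) ∧ G.Adj r w) → D.card ≤ D'.card) ∧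
      ∀ d ∈ D, ∃ a b, a ≠ b ∧ (a ∈ R ∧ a ∉ D) ∧ (b ∈ R ∧ b ∉ D) ∧ G.Adj d a ∧ G.Adj d b := by
  classical
  let dom : Finset V → Prop := fun D => (D : Set V) ⊆ R ∧
    ∀ r ∈ R, r ∉ D → ∃ w, (w ∈ D ∨ w ∈ S) ∧ G.Adj r w
  let bad : Finset V → Finset V := fun D => D.filter fun r =>
    ∃ q, ∀ y ∈ R, y ∉ D → G.Adj r y → y = q
  -- Minimise lexicographically: first the cardinality, then the number of vertices with at most one
  -- neighbour in the rest of `R`.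
  obtain ⟨D, hD, hmin⟩ := Finset.exists_min_image (Finset.univ.filter dom)
    (fun D => toLex (D.card, (bad D).card))
    ⟨R.toFinset, by simp [dom]; intro r h1 h2; exact absurd h1 h2⟩
  have hD : dom D := by simpa using hD
  have hmin : ∀ D', dom D' → D.card < D'.card ∨
      D.card = D'.card ∧ (bad D).card ≤ (bad D').card := by
    intro D' hD'
    have := hmin D' (by simpa using hD')
    rwa [Prod.Lex.toLex_le_toLex] at this
  refine ⟨D, hD.1, hD.2, fun D' h1 h2 => ?_, ?_⟩
  · rcases hmin D' ⟨h1, h2⟩ with h | h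
    · exact h.le
    · exact h.1.le
  have herase : ∀ r ∈ D, ¬ dom (D.erase r) := by
    intro r hr h
    have h1 := Finset.card_erase_lt_of_mem hr
    rcases hmin _ h with h | h <;> omega
  -- A vertex of `D` without such a neighbour could be dropped: the degree hypothesis supplies a
  -- neighbour in the rest of `D` or in `S`.
  have hout : ∀ r ∈ D, ∃ q, q ∈ R ∧ q ∉ D ∧ G.Adj r q := by
    intro r hr
    by_contra hcon
    push Not at hcon
    refine herase r hr ⟨fun x hx => hD.1 (Finset.mem_of_mem_erase hx), fun t ht htD => ?_⟩
    by_cases htr : t = r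
    · subst htr
      obtain ⟨y, hyt, hty, hy⟩ := hdeg t ht t
      refine ⟨y, ?_, hty⟩
      rcases hy with hy | hy
      · left
        rw [Finset.mem_erase]
        exact ⟨hyt, by by_contra h; exact hcon y hy h hty⟩
      · exact Or.inr hy
    · have htD' : t ∉ D := fun h => htD (Finset.mem_erase.2 ⟨htr, h⟩)
      obtain ⟨w, hw, htw⟩ := hD.2 t ht htD'
      refine ⟨w, ?_, htw⟩
      rcases hw with hw | hw
      · left
        refine Finset.mem_erase.2 ⟨?_, hw⟩
        rintro rfl
        exact hcon t ht htD' htw.symm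
      · exact Or.inr hw
  intro r hr
  obtain ⟨q, hqR, hqD, hrq⟩ := hout r hr
  by_contra hcon
  have huniq : ∀ y ∈ R, y ∉ D → G.Adj r y → y = q := by
    intro y hyR hyD hry
    by_contra hyq
    exact hcon ⟨y, q, hyq, ⟨hyR, hyD⟩, ⟨hqR, hqD⟩, hry, hrq⟩
  have hrR : r ∈ R := hD.1 hr
  have hqr : q ≠ r := hrq.ne'
  -- the vertex `q` is dominated by `r` only
  have hqdom : ∀ w, w ∈ D ∨ w ∈ S → G.Adj q w → w = r := by
    intro w hw hqw
    by_contra hwr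
    refine herase r hr ⟨fun x hx => hD.1 (Finset.mem_of_mem_erase hx), fun t ht htD => ?_⟩
    by_cases htr : t = r
    · subst htr
      obtain ⟨p, hpq, htp, hp⟩ := hdeg t ht q
      refine ⟨p, ?_, htp⟩
      rcases hp with hp | hp
      · left
        rw [Finset.mem_erase]
        exact ⟨htp.ne', by by_contra h; exact hpq (huniq p hp h htp)⟩
      · exact Or.inr hp
    · have htD' : t ∉ D := fun h => htD (Finset.mem_erase.2 ⟨htr, h⟩)
      by_cases htq : t = q
      · subst htq
        exact ⟨w, hw.imp_left fun h => Finset.mem_erase.2 ⟨hwr, h⟩, hqw⟩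
      · obtain ⟨z, hz, htz⟩ := hD.2 t ht htD'
        refine ⟨z, hz.imp_left fun h => Finset.mem_erase.2 ⟨?_, h⟩, htz⟩
        rintro rfl
        exact htq (huniq t ht htD' htz.symm)
  obtain ⟨q', hq'r, hqq', hq'⟩ := hdeg q hqR r
  have hq'D : q' ∉ D := fun h => hq'r (hqdom q' (Or.inl h) hqq')
  have hq'R : q' ∈ R := hq'.resolve_right fun h => hq'r (hqdom q' (Or.inr h) hqq')
  have hmem : ∀ y, y ∈ insert q (D.erase r) ↔ y = q ∨ (y ≠ r ∧ y ∈ D) := by simp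
  -- Exchange `r` for its only outside neighbour `q`; this keeps domination and cardinality.
  have hdom' : dom (insert q (D.erase r)) := by
    refine ⟨fun x hx => ?_, fun t ht htD => ?_⟩
    · rcases (hmem x).1 hx with rfl | h
      · exact hqR
      · exact hD.1 h.2
    · rw [hmem] at htD
      push Not at htD
      by_cases htr : t = r
      · subst htr
        exact ⟨q, Or.inl ((hmem q).2 (Or.inl rfl)), hrq⟩
      · obtain ⟨z, hz, htz⟩ := hD.2 t ht (htD.2 htr)
        refine ⟨z, hz.imp_left fun h => (hmem z).2 (Or.inr ⟨?_, h⟩), htz⟩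
        rintro rfl
        exact htD.1 (huniq t ht (htD.2 htr) htz.symm)
  have hcard : (insert q (D.erase r)).card = D.card := by
    rw [Finset.card_insert_of_notMem (fun h => hqD (Finset.mem_of_mem_erase h)),
      Finset.card_erase_add_one hr]
  -- The bad vertex `r` leaves. The entering `q` is not bad, since it sees both `r` and `q'`. No
  -- other vertex becomes bad, because none in `D` except `r` is adjacent to `q`.
  have hlt : (bad (insert q (D.erase r))).card < (bad D).card := by
    refine Finset.card_lt_card (Finset.ssubset_iff_of_subset ?_ |>.2 ⟨r, ?_, ?_⟩)
    · intro t ht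
      obtain ⟨htD, u, hu⟩ := Finset.mem_filter.1 ht
      rcases (hmem t).1 htD with rfl | ⟨htr, htD'⟩
      · have h1 := hu r hrR (by rw [hmem]; simp [hqr.symm]) hrq.symm
        have h2 := hu q' hq'R (by rw [hmem]; simp [hq'D, hqq'.ne']) hqq'
        exact absurd (h2.trans h1.symm) hq'r
      · refine Finset.mem_filter.2 ⟨htD', u, fun y hyR hyD hty => hu y hyR ?_ hty⟩
        rw [hmem]
        rintro (rfl | h)
        · exact htr (hqdom t (Or.inl htD') hty.symm)
        · exact hyD h.2
    · exact Finset.mem_filter.2 ⟨hr, q, huniq⟩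
    · intro h
      rcases (hmem r).1 (Finset.mem_filter.1 h).1 with h | h
      · exact hqr h.symm
      · exact h.1 rfl
  rcases hmin _ hdom' with h | h <;> omega

/-! ### Inner vertices and their structure -/

/-- The vertices that are neither isolated, nor leaves, nor support vertices. -/
def inner (G : SimpleGraph V) : Set V :=
  {v | (∃ w, G.Adj v w) ∧ ¬ IsLeaf G v ∧ ¬ IsSupport G v}

/-- A set of inner vertices together with all leaves at those support vertices that have another
neighbour in this set or another leaf. -/
def leafExtension (G : SimpleGraph V) (Y : Set V) : Set V :=
  Y ∪ {l | IsLeaf G l ∧ ∃ s, G.Adj l s ∧ ∃ y, y ≠ l ∧ G.Adj s y ∧ (y ∈ Y ∨ IsLeaf G y)}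

theorem IsLeaf.eq_of_adj {G : SimpleGraph V} {l s t : V} (h : IsLeaf G l) (hs : G.Adj l s)
    (ht : G.Adj l t) : s = t := h.unique hs ht

/-- The added leaves repair the support vertices: one with a single neighbour in `Y` receives a leaf
as its second shadow neighbour. So the two-neighbour condition need only be checked at inner
vertices. -/
theorem isShadow_leafExtension {G : SimpleGraph V} {Y : Set V} (hY : Y ⊆ inner G)
    (hdom : ∀ y ∈ Y, ∃ w, ((w ∈ inner G ∧ w ∉ Y) ∨ IsSupport G w) ∧ G.Adj y w)
    (htwo : ∀ v ∈ inner G, v ∉ Y → ∀ x ∈ Y, G.Adj v x → ∃ y ∈ Y, y ≠ x ∧ G.Adj v y) :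
    IsShadow G (leafExtension G Y) := by
  constructor
  · rintro x (hx | ⟨hx, s, hxs, y, hyx, hsy, hy⟩)
    · obtain ⟨w, hw, hxw⟩ := hdom x hx
      refine ⟨w, ?_, hxw⟩
      rintro (h | ⟨h, -⟩)
      · rcases hw with hw | hw
        · exact hw.2 h
        · exact (hY h).2.2 hw
      · exact (hY hx).2.2 ⟨w, h, hxw.symm⟩
    · refine ⟨s, ?_, hxs⟩
      rintro (h | ⟨h, -⟩)
      · exact (hY h).2.2 ⟨x, hx, hxs⟩
      · exact hyx (IsLeaf.eq_of_adj h hsy hxs.symm)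
  · rintro v hv x (hx | ⟨hx, s, hxs, y, hyx, hsy, hy⟩) hvx
    · by_cases hvl : IsLeaf G v
      · exact absurd ⟨v, hvl, hvx⟩ (hY hx).2.2
      by_cases hvs : IsSupport G v
      · obtain ⟨l, hl, hlv⟩ := hvs
        have hne : x ≠ l := by
          rintro rfl
          exact (hY hx).2.1 hl
        exact ⟨l, Or.inr ⟨hl, v, hlv, x, hne, hvx, Or.inl hx⟩, hne.symm, hlv.symm⟩
      · obtain ⟨y, hy, hyx, hvy⟩ :=
          htwo v ⟨⟨x, hvx⟩, hvl, hvs⟩ (fun h => hv (Or.inl h)) x hx hvx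
        exact ⟨y, Or.inl hy, hyx, hvy⟩
    · obtain rfl := IsLeaf.eq_of_adj hx hxs hvx.symm
      refine ⟨y, ?_, hyx, hsy⟩
      rcases hy with hy | hy
      · exact Or.inl hy
      · exact Or.inr ⟨hy, s, hsy.symm, x, hyx.symm, hvx, Or.inr hx⟩

theorem exists_adj_of_mem_inner {G : SimpleGraph V} {r : V} (hr : r ∈ inner G) (x : V) :
    ∃ y, y ≠ x ∧ G.Adj r y ∧ (y ∈ inner G ∨ IsSupport G y) := by
  obtain ⟨⟨w, hw⟩, hl, hs⟩ := hr
  have key : ∀ y, G.Adj r y → y ∈ inner G ∨ IsSupport G y := by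
    intro y hy
    by_cases h : IsSupport G y
    · exact Or.inr h
    · exact Or.inl ⟨⟨r, hy.symm⟩, fun h' => hs ⟨y, h', hy.symm⟩, h⟩
  by_contra hcon
  push Not at hcon
  have hall : ∀ y, G.Adj r y → y = x := by
    intro y hy
    by_contra hyx
    have := hcon y hyx hy
    rcases key y hy with h | h
    exacts [this.1 h, this.2 h]
  exact hl ⟨w, hw, fun y hy => (hall y hy).trans (hall w hw).symm⟩

/-- The structure of the inner vertices when no shadow has three elements. -/
theorem inner_structure [Fintype V] {G : SimpleGraph V}
    (hmax : ∀ X, IsShadow G X → ∀ x ∈ X, ∀ y ∈ X, ∀ z ∈ X, x = y ∨ x = z ∨ y = z)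
    (hne : (inner G).Nonempty) :
    (∀ s l l', IsLeaf G l → IsLeaf G l' → G.Adj l s → G.Adj l' s → l = l') ∧
    (∀ r ∈ inner G, ∀ s, IsSupport G s → ¬ G.Adj r s) ∧
    ((∃ a b c, inner G = {a, b, c} ∧ G.Adj a b ∧ G.Adj b c ∧ G.Adj c a) ∨
      ∃ a b c d, inner G = {a, b, c, d} ∧ G.Adj a b ∧ G.Adj b c ∧ G.Adj c d ∧ G.Adj d a ∧
        ¬ G.Adj a c ∧ ¬ G.Adj b d ∧ a ≠ c ∧ b ≠ d) := by
  classical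
  obtain ⟨D, hDR, hdom, hmin, htwo⟩ := exists_minimum_dominating G (inner G)
    {s | IsSupport G s} (fun r hr x => exists_adj_of_mem_inner hr x)
  have hX : IsShadow G (leafExtension G (inner G \ D)) := by
    refine isShadow_leafExtension Set.sdiff_subset ?_ ?_
    · rintro y ⟨hy, hyD⟩
      obtain ⟨w, hw, hyw⟩ := hdom y hy hyD
      exact ⟨w, hw.imp_left fun h => ⟨hDR h, fun h' => h'.2 h⟩, hyw⟩
    · intro v hv hvD x hx hvx
      have hvD : v ∈ D := by by_contra h; exact hvD ⟨hv, h⟩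
      obtain ⟨a, b, hab, ha, hb, hva, hvb⟩ := htwo v hvD
      by_cases hax : a = x
      · exact ⟨b, hb, fun h => hab (hax.trans h.symm), hvb⟩
      · exact ⟨a, ha, hax, hva⟩
  have hleaf_ne : ∀ {l r : V}, IsLeaf G l → r ∈ inner G → l ≠ r := by
    rintro l _ hl hr rfl
    exact hr.2.1 hl
  obtain ⟨x₀, hx₀⟩ : (inner G \ D).Nonempty := by
    obtain ⟨r, hr⟩ := hne
    by_cases hrD : r ∈ D
    · obtain ⟨a, -, -, ha, -⟩ := htwo r hrD
      exact ⟨a, ha⟩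
    · exact ⟨r, hr, hrD⟩
  -- Two leaves at one support vertex belong to the extension, and `x₀` would be a third element.
  have hweak : ∀ s l l', IsLeaf G l → IsLeaf G l' → G.Adj l s → G.Adj l' s → l = l' := by
    intro s l l' hl hl' hls hls'
    by_contra hll
    rcases hmax _ hX l (Or.inr ⟨hl, s, hls, l', Ne.symm hll, hls'.symm, Or.inr hl'⟩)
      l' (Or.inr ⟨hl', s, hls', l, hll, hls.symm, Or.inr hl⟩) x₀ (Or.inl hx₀) with h | h | h
    · exact hll h
    · exact hleaf_ne hl hx₀.1 h
    · exact hleaf_ne hl' hx₀.1 h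
  refine ⟨hweak, ?_⟩
  -- An edge from `Y` to a support vertex brings a leaf of that vertex into the shadow, as a third
  -- element besides `y` and `z`.
  have hsleaf : ∀ (Y : Set V), Y ⊆ inner G → IsShadow G (leafExtension G Y) →
      ∀ y ∈ Y, ∀ z ∈ Y, y ≠ z → ∀ s, IsSupport G s → ¬ G.Adj y s := by
    intro Y hYR hY y hy z hz hyz s ⟨l, hl, hls⟩ hys
    rcases hmax _ hY y (Or.inl hy) z (Or.inl hz) l
      (Or.inr ⟨hl, s, hls, y, (hleaf_ne hl (hYR hy)).symm, hys.symm, Or.inl hy⟩) with h | h | h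
    · exact hyz h
    · exact hleaf_ne hl (hYR hy) h.symm
    · exact hleaf_ne hl (hYR hz) h.symm
  rcases D.eq_empty_or_nonempty with rfl | ⟨d, hd⟩
  · exfalso
    -- With `D` empty every inner vertex has a support neighbour, so there is only one inner vertex.
    -- It then has two support neighbours, whose distinct leaves make the shadow too large.
    have hall : ∀ r ∈ inner G, r = x₀ := by
      intro r hr
      by_contra hrx
      obtain ⟨s, hs, hrs⟩ := hdom r hr (by simp)
      exact hsleaf _ Set.sdiff_subset hX r ⟨hr, by simp⟩ x₀ hx₀ hrx s (by simpa using hs) hrs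
    have hsup : ∀ x, ∃ s l, s ≠ x ∧ G.Adj x₀ s ∧ IsLeaf G l ∧ G.Adj l s := by
      intro x
      obtain ⟨s, hsx, h0s, hs⟩ := exists_adj_of_mem_inner hx₀.1 x
      rcases hs with hs | ⟨l, hl, hls⟩
      · exact absurd (hall s hs) h0s.ne'
      · exact ⟨s, l, hsx, h0s, hl, hls⟩
    obtain ⟨s, l, -, h0s, hl, hls⟩ := hsup x₀
    obtain ⟨s', l', hne', h0s', hl', hls'⟩ := hsup s
    rcases hmax _ hX x₀ (Or.inl hx₀)
      l (Or.inr ⟨hl, s, hls, x₀, (hleaf_ne hl hx₀.1).symm, h0s.symm, Or.inl hx₀⟩)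
      l' (Or.inr ⟨hl', s', hls', x₀, (hleaf_ne hl' hx₀.1).symm, h0s'.symm, Or.inl hx₀⟩)
      with h | h | h
    · exact hleaf_ne hl hx₀.1 h.symm
    · exact hleaf_ne hl' hx₀.1 h.symm
    · subst h
      exact hne' (IsLeaf.eq_of_adj hl hls' hls)
  obtain ⟨a, b, hab, ha, hb, hda, hdb⟩ := htwo d hd
  have hout : ∀ x ∈ inner G, x ∉ D → x = a ∨ x = b := by
    intro x hx hxD
    rcases hmax _ hX a (Or.inl ha) b (Or.inl hb) x (Or.inl ⟨hx, hxD⟩) with h | h | h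
    · exact absurd h hab
    · exact Or.inl h.symm
    · exact Or.inr h.symm
  have hDab : ∀ d ∈ D, G.Adj d a ∧ G.Adj d b := by
    intro d hd
    obtain ⟨a', b', hab', ha', hb', hda', hdb'⟩ := htwo d hd
    rcases hout a' ha'.1 ha'.2 with rfl | rfl <;> rcases hout b' hb'.1 hb'.2 with rfl | rfl
    · exact absurd rfl hab'
    · exact ⟨hda', hdb'⟩
    · exact ⟨hdb', hda'⟩
    · exact absurd rfl hab'
  have haS := hsleaf _ Set.sdiff_subset hX a ha b hb hab
  have hbS := hsleaf _ Set.sdiff_subset hX b hb a ha hab.symm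
  have hdR := hDR hd
  by_cases hone : ∀ e ∈ D, e = d
  · have hR : inner G = {d, a, b} := by
      ext x
      constructor
      · intro hx
        by_cases hxD : x ∈ D
        · simp [hone x hxD]
        · rcases hout x hx hxD with rfl | rfl <;> simp
      · rintro (rfl | rfl | rfl)
        exacts [hdR, ha.1, hb.1]
    have hadj : G.Adj a b := by
      obtain ⟨y, hyd, hay, hy⟩ := exists_adj_of_mem_inner ha.1 d
      rcases hy with hy | hy
      · rw [hR] at hy
        rcases hy with rfl | rfl | rfl
        · exact absurd rfl hyd
        · exact absurd hay (G.irrefl)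
        · exact hay
      · exact absurd hay (haS y hy)
    -- In the triangle the roles can be exchanged, so that `d` too lies in a shadow and has no
    -- support neighbour.
    have hX' : IsShadow G (leafExtension G {a, d}) := by
      refine isShadow_leafExtension ?_ ?_ ?_
      · rintro x (rfl | rfl)
        exacts [ha.1, hdR]
      · rintro y (rfl | rfl)
        · exact ⟨b, Or.inl ⟨hb.1, by simp [hab.symm, hdb.ne']⟩, hadj⟩
        · exact ⟨b, Or.inl ⟨hb.1, by simp [hab.symm, hdb.ne']⟩, hdb⟩
      · intro v hv hvY x hx hvx
        rw [hR] at hv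
        simp only [Set.mem_insert_iff, Set.mem_singleton_iff, not_or] at hv hvY
        obtain rfl : v = b := by tauto
        rcases hx with rfl | rfl
        · exact ⟨d, by simp, hda.ne, hdb.symm⟩
        · exact ⟨a, by simp, hda.ne', hadj.symm⟩
    have hdS := hsleaf {a, d} (by rintro x (rfl | rfl); exacts [ha.1, hdR]) hX' d (by simp) a
      (by simp) hda.ne
    refine ⟨?_, Or.inl ⟨d, a, b, hR, hda, hadj, hdb.symm⟩⟩
    rw [hR]
    rintro r (rfl | rfl | rfl)
    exacts [hdS, haS, hbS]
  · push Not at hone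
    obtain ⟨e, he, hed⟩ := hone
    have heR := hDR he
    have hcard2 : ∀ c ∈ D, c = d ∨ c = e := by
      -- Every vertex of `D` is adjacent to `a`, and `b` is adjacent to `d`, so `{a, d}` competes
      -- with `D`.
      have h2 : D.card ≤ ({a, d} : Finset V).card := by
        refine hmin _ ?_ ?_
        · intro x hx
          simp only [Finset.coe_insert, Finset.coe_singleton] at hx
          rcases hx with rfl | rfl
          exacts [ha.1, hdR]
        · intro r hr hrD
          by_cases h : r ∈ D
          · exact ⟨a, by simp, (hDab r h).1⟩
          · rcases hout r hr h with rfl | rfl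
            · simp at hrD
            · exact ⟨d, by simp, hdb.symm⟩
      rw [Finset.card_pair hda.ne'] at h2
      intro c hc
      by_contra hcon
      push Not at hcon
      exact absurd (Finset.two_lt_card.2 ⟨d, hd, e, he, c, hc, hed.symm, hcon.1.symm, hcon.2.symm⟩)
        (by omega)
    have hR : inner G = {d, a, e, b} := by
      ext x
      constructor
      · intro hx
        by_cases hxD : x ∈ D
        · rcases hcard2 x hxD with rfl | rfl <;> simp
        · rcases hout x hx hxD with rfl | rfl <;> simp
      · rintro (rfl | rfl | rfl | rfl)
        exacts [hdR, ha.1, heR, hb.1]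
    -- Since `D` has two elements, no single inner vertex dominates. This excludes both diagonals of
    -- the 4-cycle, and also support neighbours of `d` and `e`.
    have hsingle : ∀ c ∈ inner G, ¬ ∀ r ∈ inner G, r ≠ c →
        G.Adj r c ∨ ∃ s, IsSupport G s ∧ G.Adj r s := by
      intro c hc h
      have h2 : D.card ≤ ({c} : Finset V).card := by
        refine hmin _ (by simpa using hc) ?_
        intro r hr hrc
        rcases h r hr (by simpa using hrc) with h | ⟨s, hs, hrs⟩
        · exact ⟨c, by simp, h⟩
        · exact ⟨s, Or.inr hs, hrs⟩
      have h3 := Finset.one_lt_card.2 ⟨d, hd, e, he, hed.symm⟩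
      simp only [Finset.card_singleton] at h2
      omega
    obtain ⟨hea, heb⟩ := hDab e he
    have hdS : ∀ s, IsSupport G s → ¬ G.Adj d s := by
      intro s hs hds
      refine hsingle e heR ?_
      rw [hR]
      rintro r (rfl | rfl | rfl | rfl) hre
      exacts [Or.inr ⟨s, hs, hds⟩, Or.inl hea.symm, absurd rfl hre, Or.inl heb.symm]
    have heS : ∀ s, IsSupport G s → ¬ G.Adj e s := by
      intro s hs hes
      refine hsingle d hdR ?_
      rw [hR]
      rintro r (rfl | rfl | rfl | rfl) hre
      exacts [absurd rfl hre, Or.inl hda.symm, Or.inr ⟨s, hs, hes⟩, Or.inl hdb.symm]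
    refine ⟨?_, Or.inr ⟨d, a, e, b, hR, hda, hea.symm, heb, hdb.symm, ?_, ?_, hed.symm, hab⟩⟩
    · rw [hR]
      rintro r (rfl | rfl | rfl | rfl)
      exacts [hdS, haS, heS, hbS]
    · intro hde
      refine hsingle d hdR ?_
      rw [hR]
      rintro r (rfl | rfl | rfl | rfl) hre
      exacts [absurd rfl hre, Or.inl hda.symm, Or.inl hde.symm, Or.inl hdb.symm]
    · intro hadj
      refine hsingle a ha.1 ?_
      rw [hR]
      rintro r (rfl | rfl | rfl | rfl) hre
      exacts [Or.inl hda, absurd rfl hre, Or.inl hea, Or.inl hadj.symm]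

/-! ### Assembling embeddings into isomorphisms -/

theorem exists_embedding_sum {G : SimpleGraph V} {G₁ : SimpleGraph A} {G₂ : SimpleGraph B}
    (f : G₁ ↪g G) (g : G₂ ↪g G) (h : ∀ a b, f a ≠ g b ∧ ¬ G.Adj (f a) (g b)) :
    ∃ e : (G₁ ⊕g G₂) ↪g G, (∀ a, e (Sum.inl a) = f a) ∧ ∀ b, e (Sum.inr b) = g b := by
  refine ⟨⟨⟨Sum.elim f g, f.injective.sumElim g.injective fun a b => (h a b).1⟩, ?_⟩,
    fun _ => rfl, fun _ => rfl⟩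
  rintro (a | a) (b | b)
  · simp
  · simpa using (h a b).2
  · simpa using fun h' => (h b a).2 (SimpleGraph.Adj.symm h')
  · simp

theorem exists_embedding_corona {G : SimpleGraph V} {T : Set V} (l : T → V)
    (hl : ∀ t v, G.Adj (l t) v ↔ v = t) (hlT : ∀ t, l t ∉ T) :
    ∃ e : corona (G.induce T) ↪g G, (∀ t, e (Sum.inl t) = t) ∧ ∀ t, e (Sum.inr t) = l t := by
  refine ⟨⟨⟨Sum.elim (↑) l, Subtype.val_injective.sumElim ?_ ?_⟩, ?_⟩, fun _ => rfl, fun _ => rfl⟩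
  · intro t t' h
    have := (hl t t).2 rfl
    rw [h, hl] at this
    exact Subtype.ext this
  · intro t t' h
    exact hlT t' (h ▸ t.2)
  · rintro (a | a) (b | b)
    · exact Iff.rfl
    · change G.Adj a (l b) ↔ a = b
      rw [G.adj_comm, hl, Subtype.ext_iff]
    · change G.Adj (l a) b ↔ a = b
      rw [hl, Subtype.ext_iff, eq_comm]
    · change G.Adj (l a) (l b) ↔ False
      rw [hl, iff_false]
      exact fun h => hlT b (h ▸ a.2)

theorem exists_embedding_addPendant {G : SimpleGraph V} {W : Type u} {G' : SimpleGraph W}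
    (f : G' ↪g G) {s : W} {l : V} (hl : ∀ v, G.Adj l v ↔ v = f s) (hlf : ∀ a, f a ≠ l) :
    ∃ e : addPendant G' s ↪g G, e none = l ∧ ∀ a, e (some a) = f a := by
  refine ⟨⟨⟨fun o => o.elim l f, ?_⟩, ?_⟩, rfl, fun _ => rfl⟩
  · rintro (_ | a) (_ | b) h
    · rfl
    · exact absurd (Eq.symm h) (hlf b)
    · exact absurd h (hlf a)
    · exact congrArg some (f.injective h)
  · rintro (_ | a) (_ | b)
    · change G.Adj l l ↔ False
      simp
    · change G.Adj l (f b) ↔ b = s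
      rw [hl, f.injective.eq_iff]
    · change G.Adj (f a) l ↔ a = s
      rw [G.adj_comm, hl, f.injective.eq_iff]
    · exact f.map_adj_iff

theorem exists_iso_sum_bot [Fintype V] {G : SimpleGraph V} {G' : SimpleGraph A} (f : G' ↪g G)
    (hf : ∀ v, v ∈ Set.range f ↔ ∃ w, G.Adj v w) :
    ∃ k, Nonempty (G ≃g G' ⊕g (⊥ : SimpleGraph (Fin k))) := by
  classical
  let I : Set V := {v | ¬ ∃ w, G.Adj v w}
  let i : Fin (Fintype.card I) ≃ I := (Fintype.equivFin I).symm
  have hI : ∀ j v, ¬ G.Adj (i j) v := fun j v h => (i j).2 ⟨v, h⟩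
  let g : (⊥ : SimpleGraph (Fin (Fintype.card I))) ↪g G :=
    ⟨⟨fun j => i j, Subtype.val_injective.comp i.injective⟩, fun {a b} => by
      simpa using hI a (i b)⟩
  obtain ⟨e, he₁, he₂⟩ := exists_embedding_sum f g fun a b =>
    ⟨fun h => (i b).2 ((hf _).1 ⟨a, h⟩), fun h => hI b _ h.symm⟩
  have hsurj : Function.Surjective e := by
    intro v
    by_cases hv : ∃ w, G.Adj v w
    · obtain ⟨a, rfl⟩ := (hf v).2 hv
      exact ⟨_, he₁ a⟩
    · refine ⟨Sum.inr (i.symm ⟨v, hv⟩), (he₂ _).trans ?_⟩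
      change ((i (i.symm ⟨v, hv⟩) : I) : V) = v
      rw [Equiv.apply_symm_apply]
  exact ⟨_, ⟨(RelIso.ofSurjective e hsurj).symm⟩⟩

/-- If every support vertex has exactly one leaf outside `Z`, the leaves outside `Z` and the
support vertices are paired off. -/
theorem exists_pairing [Fintype V] (G : SimpleGraph V) (Z : Set V)
    (huniq : ∀ s l l', IsLeaf G l → IsLeaf G l' → G.Adj l s → G.Adj l' s → l ∉ Z → l' ∉ Z → l = l')
    (hex : ∀ s, IsSupport G s → ∃ l, IsLeaf G l ∧ G.Adj l s ∧ l ∉ Z)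
    (hZ : ∀ z ∈ Z, ¬ IsSupport G z) :
    ∃ (T : Set V) (l : T → V), (∀ t ∈ T, IsSupport G t) ∧ (∀ t, IsLeaf G (l t)) ∧
      (∀ t v, G.Adj (l t) v ↔ v = t) ∧ (∀ t, l t ∉ T) ∧ (∀ t, l t ∉ Z) ∧
      (∀ v, (IsLeaf G v ∧ v ∉ Z) ∨ IsSupport G v → v ∈ T ∨ ∃ t, l t = v) ∧
      ∀ s, IsSupport G s → ¬ IsLeaf G s → s ∈ T := by
  let φ := Fintype.equivFin V
  -- In a component with two vertices both ends are leaves and support vertices; the numbering `φ`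
  -- decides which end becomes the base vertex of the corona.
  let P : V → V → Prop := fun t l => IsLeaf G l ∧ G.Adj l t ∧ l ∉ Z ∧ (¬ IsLeaf G t ∨ φ t < φ l)
  have hch : ∀ t : {t | IsSupport G t ∧ ∃ l, P t l}, ∃ l, P t l := fun t => t.2.2
  choose l hl using hch
  have hT : ∀ s, IsSupport G s → ¬ IsLeaf G s → IsSupport G s ∧ ∃ l, P s l := by
    intro s hs hsl
    obtain ⟨m, hm, hms, hmZ⟩ := hex s hs
    exact ⟨hs, m, hm, hms, hmZ, Or.inl hsl⟩
  have hleaf : ∀ v, IsLeaf G v → v ∉ Z → (IsSupport G v ∧ ∃ l, P v l) ∨ ∃ t, l t = v := by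
    intro v hv hvZ
    obtain ⟨t, hvt, -⟩ := id hv
    have hts : IsSupport G t := ⟨v, hv, hvt⟩
    have key : (IsSupport G t ∧ ∃ l, P t l) → ∃ t, l t = v := fun h =>
      ⟨⟨t, h⟩, huniq t _ _ (hl ⟨t, h⟩).1 hv (hl ⟨t, h⟩).2.1 hvt (hl ⟨t, h⟩).2.2.1 hvZ⟩
    by_cases ht : IsLeaf G t
    · rcases lt_trichotomy (φ v) (φ t) with h | h | h
      · have hvs : IsSupport G v := ⟨t, ht, hvt.symm⟩
        exact Or.inl ⟨hvs, t, ht, hvt.symm, fun hz => hZ t hz hts, Or.inr h⟩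
      · exact absurd (φ.injective h) hvt.ne
      · exact Or.inr (key ⟨hts, v, hv, hvt, hvZ, Or.inr h⟩)
    · exact Or.inr (key ⟨hts, v, hv, hvt, hvZ, Or.inl ht⟩)
  refine ⟨{t | IsSupport G t ∧ ∃ l, P t l}, l, fun t ht => ht.1, fun t => (hl t).1,
    fun t v => ⟨fun h => IsLeaf.eq_of_adj (hl t).1 h (hl t).2.1, fun h => h ▸ (hl t).2.1⟩, ?_,
    fun t => (hl t).2.2.1, ?_, hT⟩
  · rintro t ⟨-, m, hm, hmt, hmZ, hlt⟩
    have h1 := hl t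
    obtain rfl : m = t := IsLeaf.eq_of_adj h1.1 hmt.symm h1.2.1
    rcases hlt with h | h
    · exact h h1.1
    · rcases h1.2.2.2 with h' | h'
      · exact h' hm
      · exact lt_asymm h h'
  · rintro v (⟨hv, hvZ⟩ | hv)
    · exact hleaf v hv hvZ
    · by_cases hvl : IsLeaf G v
      · exact hleaf v hvl fun hz => hZ v hz hv
      · exact Or.inl (hT v hv hvl)

/-! ### The converse: recovering the graph -/

theorem exists_adj_of_isSupport {G : SimpleGraph V} {s : V} (h : IsSupport G s) :
    ∃ w, G.Adj s w := by
  obtain ⟨l, -, h⟩ := h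
  exact ⟨l, h.symm⟩

theorem exists_iso_of_inner_eq_empty [Fintype V] {G : SimpleGraph V} (h : ShadowNumberTwo G)
    (hR : inner G = ∅) : ∃ (B : Type u) (G₀ : SimpleGraph B) (k : ℕ), IsC3OrC4OrDiadem G₀ ∧
      Nonempty (G ≃g G₀ ⊕g (⊥ : SimpleGraph (Fin k))) := by
  obtain ⟨⟨x, y, hxy, hX⟩, hmax⟩ := h
  have htypes : ∀ v, (∃ w, G.Adj v w) → IsLeaf G v ∨ IsSupport G v := by
    intro v hv
    by_contra hcon
    push Not at hcon
    exact Set.eq_empty_iff_forall_notMem.1 hR v ⟨hv, hcon⟩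
  have hleafX : ∀ v ∈ ({x, y} : Set V), IsLeaf G v := by
    intro v hv
    obtain ⟨w, -, hvw⟩ := hX.1 v hv
    exact (htypes v ⟨w, hvw⟩).resolve_right fun h => hX.not_mem_of_isSupport h hv
  obtain ⟨s, hs, hxs⟩ := hX.1 x (by simp)
  have hys : G.Adj y s := by
    obtain ⟨z, hz, hzx, hsz⟩ := hX.2 s hs x (by simp) hxs.symm
    rcases hz with rfl | rfl
    · exact absurd rfl hzx
    · exact hsz.symm
  have hx := hleafX x (by simp)
  have hy := hleafX y (by simp)
  -- This shadow consists of all leaves that share their support vertex with another leaf; it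
  -- contains `x` and `y`, hence nothing else.
  have hE : IsShadow G (leafExtension G ∅) :=
    isShadow_leafExtension (Set.empty_subset _) (by simp) (by simp)
  have hstrong : ∀ t l l', IsLeaf G l → IsLeaf G l' → G.Adj l t → G.Adj l' t → l ≠ l' →
      l = x ∨ l = y := by
    intro t l l' hl hl' hlt hl't hne
    rcases hmax _ hE l (Or.inr ⟨hl, t, hlt, l', hne.symm, hl't.symm, Or.inr hl'⟩)
      x (Or.inr ⟨hx, s, hxs, y, hxy.symm, hys.symm, Or.inr hy⟩)
      y (Or.inr ⟨hy, s, hys, x, hxy, hxs.symm, Or.inr hx⟩) with h | h | h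
    exacts [Or.inl h, Or.inr h, absurd h hxy]
  have hsl : ¬ IsLeaf G s := fun h => hxy (IsLeaf.eq_of_adj h hxs.symm hys.symm)
  have hss : IsSupport G s := ⟨x, hx, hxs⟩
  -- So `y` can be set aside as the extra pendant vertex of the diadem; every support vertex keeps
  -- exactly one other leaf.
  have hyS : ¬ IsSupport G y := by
    rintro ⟨m, hm, hmy⟩
    rw [IsLeaf.eq_of_adj hy hmy.symm hys] at hm
    exact hsl hm
  obtain ⟨T, l, hT, hl, hladj, hlT, hlZ, hcov, hTs⟩ := exists_pairing G {y}
    (by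
      intro t m m' hm hm' hmt hmt' hmy hmy'
      by_contra hne
      have h1 := (hstrong t m m' hm hm' hmt hmt' hne).resolve_right hmy
      have h2 := (hstrong t m' m hm' hm hmt' hmt (Ne.symm hne)).resolve_right hmy'
      exact hne (h1.trans h2.symm))
    (by
      rintro t ⟨m, hm, hmt⟩
      by_cases hmy : m = y
      · subst hmy
        rw [IsLeaf.eq_of_adj hm hmt hys]
        exact ⟨x, hx, hxs, hxy⟩
      · exact ⟨m, hm, hmt, hmy⟩)
    (by rintro z rfl; exact hyS)
  obtain ⟨f, hf₁, hf₂⟩ := exists_embedding_corona l hladj hlT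
  obtain ⟨e, he₁, he₂⟩ := exists_embedding_addPendant f (s := Sum.inl ⟨s, hTs s hss hsl⟩) (l := y)
    (by
      intro v
      rw [hf₁]
      exact ⟨fun h => IsLeaf.eq_of_adj hy h hys, fun h => h ▸ hys⟩)
    (by
      rintro (t | t)
      · rw [hf₁]
        rintro h
        exact hyS (h ▸ hT t t.2)
      · rw [hf₂]
        exact hlZ t)
  obtain ⟨k, hk⟩ := exists_iso_sum_bot e (by
    intro v
    constructor
    · rintro ⟨_ | t | t, rfl⟩
      · exact ⟨s, he₁ ▸ hys⟩
      · rw [he₂, hf₁]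
        exact exists_adj_of_isSupport (hT t t.2)
      · rw [he₂, hf₂]
        exact ⟨t, (hladj t t).2 rfl⟩
    · intro hv
      by_cases hvy : v = y
      · exact ⟨none, he₁.trans hvy.symm⟩
      · rcases hcov v ((htypes v hv).imp_left fun h => ⟨h, hvy⟩) with h | ⟨t, rfl⟩
        · exact ⟨some (Sum.inl ⟨v, h⟩), (he₂ _).trans (hf₁ _)⟩
        · exact ⟨some (Sum.inr t), (he₂ _).trans (hf₂ _)⟩)
  exact ⟨_, _, k, Or.inr (Or.inr ⟨T, G.induce T, _, isSupport_corona_inl _ _, ⟨Iso.refl⟩⟩), hk⟩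

theorem nonempty_iso_induce_range {G : SimpleGraph V} {G' : SimpleGraph A} {p : A → V}
    (hp : Function.Injective p) (hadj : ∀ i j, G.Adj (p i) (p j) ↔ G'.Adj i j) {R : Set V}
    (hR : R = Set.range p) : Nonempty (G.induce R ≃g G') := by
  subst hR
  let f : G' ↪g G := ⟨⟨p, hp⟩, hadj _ _⟩
  exact ⟨f.isoInduceRange.symm⟩

theorem isC3OrC4OrDiadem_induce {G : SimpleGraph V} {R : Set V}
    (h : (∃ a b c, R = {a, b, c} ∧ G.Adj a b ∧ G.Adj b c ∧ G.Adj c a) ∨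
      ∃ a b c d, R = {a, b, c, d} ∧ G.Adj a b ∧ G.Adj b c ∧ G.Adj c d ∧ G.Adj d a ∧
        ¬ G.Adj a c ∧ ¬ G.Adj b d ∧ a ≠ c ∧ b ≠ d) :
    IsC3OrC4OrDiadem (G.induce R) := by
  rcases h with ⟨a, b, c, hR, hab, hbc, hca⟩ |
    ⟨a, b, c, d, hR, hab, hbc, hcd, hda, hac, hbd, h, h'⟩
  · left
    refine nonempty_iso_induce_range (p := ![a, b, c]) ?_ ?_ ?_
    · intro i j
      fin_cases i <;> fin_cases j <;>
        simp [hab.ne, hbc.ne, hca.ne, hab.ne', hbc.ne', hca.ne']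
    · intro i j
      fin_cases i <;> fin_cases j <;> first
        | exact iff_of_false G.irrefl (by decide)
        | exact iff_of_true (by assumption) (by decide)
        | exact iff_of_true (SimpleGraph.Adj.symm (by assumption)) (by decide)
    · ext v
      simp [hR, eq_comm (a := v)]
      tauto
  · right; left
    refine nonempty_iso_induce_range (p := ![a, b, c, d]) ?_ ?_ ?_
    · intro i j
      fin_cases i <;> fin_cases j <;>
        simp [hab.ne, hbc.ne, hcd.ne, hda.ne, hab.ne', hbc.ne', hcd.ne', hda.ne', h, h', h.symm,
          h'.symm]
    · intro i j
      fin_cases i <;> fin_cases j <;> first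
        | exact iff_of_false G.irrefl (by decide)
        | exact iff_of_true (by assumption) (by decide)
        | exact iff_of_true (SimpleGraph.Adj.symm (by assumption)) (by decide)
        | exact iff_of_false (by assumption) (by decide)
        | exact iff_of_false (fun h => absurd (SimpleGraph.Adj.symm h) (by assumption)) (by decide)
    · ext v
      simp [hR, eq_comm (a := v)]
      tauto

/-- The inner vertices split off, as they have no edges to leaves or support vertices. Each support
vertex has just one leaf, so the leaves and support vertices form a corona, and only isolated
vertices remain. -/
theorem exists_iso_of_inner_nonempty [Fintype V] {G : SimpleGraph V} (h : ShadowNumberTwo G)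
    (hR : (inner G).Nonempty) :
    ∃ (B : Type u) (G₀ : SimpleGraph B) (W : Type u) (H : SimpleGraph W) (k : ℕ),
      IsC3OrC4OrDiadem G₀ ∧ Nonempty (G ≃g G₀ ⊕g corona H ⊕g (⊥ : SimpleGraph (Fin k))) := by
  obtain ⟨huniq, hsupp, hcases⟩ := inner_structure h.2 hR
  obtain ⟨T, l, hT, hl, hladj, hlT, -, hcov, -⟩ := exists_pairing G ∅
    (fun s m m' hm hm' hms hms' _ _ => huniq s m m' hm hm' hms hms')
    (fun s ⟨m, hm, hms⟩ => ⟨m, hm, hms, by simp⟩) (by simp)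
  obtain ⟨f, hf₁, hf₂⟩ := exists_embedding_corona l hladj hlT
  obtain ⟨e, he₁, he₂⟩ := exists_embedding_sum (Embedding.induce (G := G) (inner G)) f (by
    rintro r (t | t)
    · rw [hf₁]
      refine ⟨fun h => ?_, hsupp r r.2 t (hT t t.2)⟩
      have h : (r : V) = t := h
      exact r.2.2.2 (h ▸ hT t t.2)
    · rw [hf₂]
      refine ⟨fun h => ?_, fun h => r.2.2.2 ⟨l t, hl t, h.symm⟩⟩
      have h : (r : V) = l t := h
      exact r.2.2.1 (h ▸ hl t))
  obtain ⟨k, hk⟩ := exists_iso_sum_bot e (by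
    intro v
    constructor
    · rintro ⟨r | t | t, rfl⟩
      · rw [he₁]
        exact r.2.1
      · rw [he₂, hf₁]
        exact exists_adj_of_isSupport (hT t t.2)
      · rw [he₂, hf₂]
        exact ⟨t, (hladj t t).2 rfl⟩
    · intro hv
      by_cases hvR : v ∈ inner G
      · exact ⟨Sum.inl ⟨v, hvR⟩, he₁ _⟩
      · have hv' : (IsLeaf G v ∧ v ∉ (∅ : Set V)) ∨ IsSupport G v := by
          by_contra hcon
          push Not at hcon
          exact hvR ⟨hv, fun h => by simpa using hcon.1 h, hcon.2⟩
        rcases hcov v hv' with h | ⟨t, rfl⟩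
        · exact ⟨Sum.inr (Sum.inl ⟨v, h⟩), (he₂ _).trans (hf₁ _)⟩
        · exact ⟨Sum.inr (Sum.inr t), (he₂ _).trans (hf₂ _)⟩)
  exact ⟨_, _, _, _, k, isC3OrC4OrDiadem_induce hcases, hk⟩

end CertDom

theorem mainTheorem2 {V : Type u} [Fintype V] (G : SimpleGraph V) (hn : 3 ≤ Fintype.card V) :
    CertDom.certDomNumber G = Fintype.card V - 2 ↔
      CertDom.IsC3OrC4OrDiadem G ∨
      (∃ (B : Type u) (G₀ : SimpleGraph B) (k : ℕ), CertDom.IsC3OrC4OrDiadem G₀ ∧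
        Nonempty (G ≃g G₀ ⊕g (⊥ : SimpleGraph (Fin k)))) ∨
      (∃ (B : Type u) (G₀ : SimpleGraph B) (W : Type u) (H : SimpleGraph W) (k : ℕ),
        CertDom.IsC3OrC4OrDiadem G₀ ∧
        Nonempty (G ≃g G₀ ⊕g CertDom.corona H ⊕g (⊥ : SimpleGraph (Fin k)))) := by
  rw [CertDom.certDomNumber_eq_iff G hn]
  constructor
  · intro h
    rcases (CertDom.inner G).eq_empty_or_nonempty with hR | hR
    -- The first alternative is never needed here: it is the second one with `k = 0`.
    · exact Or.inr (Or.inl (CertDom.exists_iso_of_inner_eq_empty h hR))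
    · exact Or.inr (Or.inr (CertDom.exists_iso_of_inner_nonempty h hR))
  · rintro (h | ⟨B, G₀, k, h, ⟨e⟩⟩ | ⟨B, G₀, W, H, k, h, ⟨e⟩⟩)
    · exact h.shadowNumberTwo
    · exact (h.shadowNumberTwo.sum CertDom.shadowNumberZero_bot).of_iso e
    · exact ((h.shadowNumberTwo.sum (CertDom.shadowNumberZero_corona H)).sum
        CertDom.shadowNumberZero_bot).of_iso e
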